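/- **Setting.** Let $K\ge 2$ be the number of arms and, for each arm $k$, let $\Theta_k$ be a set of probability measures on $[0,1]$; put $\Theta=\Theta_1\times\dots\times\Theta_K$. For an environment $\theta=(\nu_1,\dots,\nu_K)\in\Theta$ let $\mu_k=\int x\,d\nu_k(x)$ and $\mu^*=\max_k\mu_k$, and fix an arm $k^*$ with $\mu_{k^*}=\mu^*$. A policy is a sequence $(\sigma_t)_{t\ge1}$, where $\sigma_t$ is a measurable map from $\{1,\dots,K\}^{t-1}\times[0,1]^{t-1}$ (past actions and past rewards) to the set of probabilities on $\{1,\dots,K\}$; it may depend on the number of rounds $n$ if $n$ is known in advance. Under $\mathbb P_\theta$ the rewards $X_{k,1},\dots,X_{k,n}$ of arm $k$ are i.i.d. with law $\nu_k$, and these $K$ sequences are independent. At round $t=1,\dots,n$ the arm $I_t$ is drawn, given the past and the rewards $(X_{k,s})$, from the probability that $\sigma_t$ assigns to the past actions and observed rewards, and the reward $X_{I_t,T_{I_t}(t)}$ is observed, where $T_k(t)=\sum_{s=1}^t\mathbf 1_{\{I_s=k\}}$. The regret is $$R_n=\sum_{t=1}^nX_{k^*,t}-\sum_{t=1}^nX_{I_t,T_{I_t}(t)}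 .$$ For $\alpha\in[0,1]$ the policy is called $\alpha$-consistent if $\mathbb E_\theta[R_n]=o(n^a)$ as $n\to\infty$ for all $a>\alpha$ and all $\theta\in\Theta$. Finally let $$D_k(\theta)=\inf\bigl\{KL(\nu_k,\tilde\nu)\;:\;\tilde\nu\in\Theta_k,\ \textstyle\int x\,d\tilde\nu(x)>\mu^*\bigr\}\in[0,+\infty],$$ where $KL$ is the Kullback–Leibler divergence and $\inf\emptyset=+\infty$. **Theorem.** Let $\alpha\in[0,1]$, fix an $\alpha$-consistent policy and $\theta\in\Theta$. If $k$ is a suboptimal arm (i.e. $\mu_k<\mu^*$) and $0<D_k(\theta)<+\infty$, then $$\forall\varepsilon>0,\qquad \lim_{n\to+\infty}\mathbb P_\theta\left[T_k(n)\ge(1-\varepsilon)\frac{(1-\alpha)\log n}{D_k(\theta)}\right]=1 ,$$ and consequently $$\liminf_{n\to+\infty}\frac{\mathbb E_\theta[T_k(n)]}{\log n}\ \ge\ \frac{1-\alpha}{D_k(\theta)} .$$ -/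

import Mathlib

open MeasureTheory ProbabilityTheory Filter Topology Asymptotics InformationTheory
open scoped ENNReal unitInterval

noncomputable section

namespace Bandit

/-- Reward distributions: probability measures on `[0,1]`. -/
abbrev RewardDist : Type := ProbabilityMeasure I

/-- An environment `θ = (ν_1, …, ν_K)`. -/
abbrev Env (K : ℕ) : Type := Fin K → RewardDist

/-- Mean of a reward distribution. -/
def mean (ν : RewardDist) : ℝ := ∫ x, (x : ℝ) ∂(ν : Measure I)

/-- The best mean `μ^* = max_k μ_k`. -/
def bestMean {K : ℕ} (θ : Env K) : ℝ := ⨆ k, mean (θ k)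

/-- `D_k(θ)`, the infimum of `KL(ν_k, ν̃)` over those `ν̃ ∈ Θ_k` whose mean exceeds `μ^*`
(it is `∞` if there is no such `ν̃`). -/
def infKL {K : ℕ} (Θ : Fin K → Set RewardDist) (θ : Env K) (k : Fin K) : ℝ≥0∞ :=
  ⨅ ν ∈ {ν | ν ∈ Θ k ∧ bestMean θ < mean ν}, klDiv (θ k : Measure I) (ν : Measure I)

/-- A (possibly randomized) policy: for each `t`, a measurable map that sends the `t` past actions
and the `t` past rewards to a probability on the arms, from which the next arm is drawn.
Rounds are numbered from `0`. -/
structure Policy (K : ℕ) where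
  choice : ∀ t : ℕ, Kernel ((Fin t → Fin K) × (Fin t → I)) (Fin K)
  isMarkov : ∀ t, IsMarkovKernel (choice t)

/-- Reward tables for a game of `n` rounds: `x k s` is the reward of the `(s+1)`-st pull of
arm `k`. -/
abbrev Table (K n : ℕ) : Type := Fin K → Fin n → I

/-- Outcomes of a game of `n` rounds: the reward table, and the arms that were played. -/
abbrev Outcome (K n : ℕ) : Type := Table K n × (Fin n → Fin K)

/-- Number of rounds before round `s` at which the arm played at round `s` was already played. -/
def earlierPulls {K t : ℕ} (a : Fin t → Fin K) (s : Fin t) : ℕ :=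
  (Finset.univ.filter fun r : Fin t => r < s ∧ a r = a s).card

theorem earlierPulls_lt {K t : ℕ} (a : Fin t → Fin K) (s : Fin t) : earlierPulls a s < t := by
  refine lt_of_lt_of_eq (Finset.card_lt_univ_of_notMem (x := s) ?_) (Fintype.card_fin t)
  simp

/-- Rewards received in the first `t` rounds if the arms `a` are played: when an arm is played for
the `(j+1)`-st time, entry number `j` (counted from `0`) of its row in the table is received. -/
def rewards {K n t : ℕ} (ht : t ≤ n) (x : Table K n) (a : Fin t → Fin K) (s : Fin t) : I :=
  x (a s) ⟨earlierPulls a s, (earlierPulls_lt a s).trans_le ht⟩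

/-- Conditional probability, given the reward table, that the policy `pol` plays the arms `a`: the
product over the rounds of the probability with which `pol` picks the arm of that round after the
actions and rewards of the earlier rounds. -/
def playProb {K n : ℕ} (pol : Policy K) (ω : Outcome K n) : ℝ≥0∞ :=
  ∏ t : Fin n,
    pol.choice t (Fin.take t t.isLt.le ω.2, rewards t.isLt.le ω.1 (Fin.take t t.isLt.le ω.2)) {ω.2 t}

/-- The law `P_θ` of a game of `n` rounds: the rewards `X_{k,1}, …, X_{k,n}` of each arm `k` are
i.i.d. with law `ν_k`, the rows of the table are independent, and given the table the arms `a` are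
played with probability `playProb`. -/
def law {K : ℕ} (pol : Policy K) (θ : Env K) (n : ℕ) : Measure (Outcome K n) :=
  ((Measure.pi fun k => Measure.pi fun _ : Fin n => (θ k : Measure I)).prod
    Measure.count).withDensity (playProb pol)

/-- `T_k(n)`, the number of pulls of arm `k` during the game. -/
def pulls {K n : ℕ} (k : Fin K) (ω : Outcome K n) : ℕ :=
  (Finset.univ.filter fun t : Fin n => ω.2 t = k).card

/-- The regret `R_n = ∑_t X_{k^*,t} - ∑_t X_{I_t, T_{I_t}(t)}` with respect to the arm `kstar`. -/
def regret {K n : ℕ} (kstar : Fin K) (ω : Outcome K n) : ℝ :=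
  ∑ t : Fin n, (ω.1 kstar t : ℝ) - ∑ t : Fin n, (rewards le_rfl ω.1 ω.2 t : ℝ)

/-- `α`-consistency over `Θ = Θ_1 × ⋯ × Θ_K`: for every environment `θ ∈ Θ`, with a fixed best arm
`kstar`, `E_θ[R_n] = o(n^a)` for all `a > α`. Here `pol n` is the policy used when the number of
rounds is `n`; a constant family is a policy that does not know the number of rounds. -/
def IsConsistent {K : ℕ} (Θ : Fin K → Set RewardDist) (α : ℝ) (pol : ℕ → Policy K) : Prop :=
  ∀ θ : Env K, (∀ k, θ k ∈ Θ k) →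
    ∃ kstar : Fin K, mean (θ kstar) = bestMean θ ∧
      ∀ a : ℝ, α < a →
        (fun n : ℕ => ∫ ω, regret kstar ω ∂(law (pol n) θ n)) =o[atTop] fun n : ℕ => (n : ℝ) ^ a

end Bandit

end

/-!
Let `ν̃ ∈ Θ_k` have mean above `μ^*`, with `KL(ν_k, ν̃)` close to `D_k(θ)`, and let `θ'` be `θ`
with `ν_k` replaced by `ν̃`, so that `k` is the unique best arm of `θ'`. Choose
`c > KL(ν_k, ν̃)` and `β > 0` with `c β < 1 - α`, and set `F = ⌊β log n⌋`.

Given the reward table, the probability of `{T_k(n) ≤ F}` only involves the first `F` rewards of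
arm `k`. So only the first `F` factors of the likelihood ratio between `θ` and `θ'` matter, and by
the law of large numbers their product is at most `exp (c F) ≤ n ^ (c β)` outside an event whose
probability tends to `0`. Hence `P_θ(T_k(n) ≤ F) ≤ o(1) + n ^ (c β) P_θ'(T_k(n) ≤ F)`. Under `θ'`
the other arms are pulled `o(n ^ a)` times in expectation for all `a > α`, so by Markov's inequality
`P_θ'(T_k(n) ≤ n / 2) = o(n ^ (a - 1))`; take `a = 1 - c β`.
-/

section ProductMeasures

variable {ι : Type*} [Fintype ι] {X : ι → Type*} [∀ i, MeasurableSpace (X i)]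
  {μ ν : ∀ i, Measure (X i)} [∀ i, IsProbabilityMeasure (μ i)] [∀ i, IsProbabilityMeasure (ν i)]

theorem lmarginal_compl_of_dependsOn [DecidableEq ι] {S : Finset ι} {f : (∀ i, X i) → ℝ≥0∞}
    (hS : DependsOn f S) : ∫⋯∫⁻_Sᶜ, f ∂μ = f := by
  ext x
  have hconst : ∀ y : ∀ i : (Sᶜ : Finset ι), X i, f (Function.updateFinset x Sᶜ y) = f x :=
    fun y => hS fun i hi => by
      simp [Function.updateFinset, Finset.mem_coe.1 hi]
  simp [lmarginal, hconst]

theorem lintegral_pi_congr_of_dependsOn {S : Finset ι} {f : (∀ i, X i) → ℝ≥0∞}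
    (hf : Measurable f) (hS : DependsOn f S) (h : ∀ i ∈ S, μ i = ν i) :
    ∫⁻ x, f x ∂Measure.pi μ = ∫⁻ x, f x ∂Measure.pi ν := by
  classical
  have hX : ∀ i, Nonempty (X i) := fun i => nonempty_of_isProbabilityMeasure (μ i)
  let x₀ : ∀ i, X i := fun i => (hX i).some
  have hmarginal : ∀ ρ : ∀ i, Measure (X i), (∀ i, IsProbabilityMeasure (ρ i)) →
      ∫⁻ x, f x ∂Measure.pi ρ = (∫⋯∫⁻_S, f ∂ρ) x₀ := fun ρ _ => by
    rw [lintegral_eq_lmarginal_univ x₀, ← Finset.union_compl S,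
      lmarginal_union ρ f hf disjoint_compl_right, lmarginal_compl_of_dependsOn hS]
  rw [hmarginal μ inferInstance, hmarginal ν inferInstance]
  simp only [lmarginal, fun i : S => h i i.2]

theorem pi_apply_congr_of_dependsOn {S : Finset ι} {E : Set (∀ i, X i)} (hE : MeasurableSet E)
    (hS : DependsOn (· ∈ E) S) (h : ∀ i ∈ S, μ i = ν i) : Measure.pi μ E = Measure.pi ν E := by
  classical
  rw [← lintegral_indicator_one hE, ← lintegral_indicator_one hE]
  refine lintegral_pi_congr_of_dependsOn (measurable_one.indicator hE) (fun x y hxy => ?_) h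
  simp only [Set.indicator_apply, Pi.one_apply, hS hxy]

theorem lintegral_pi_mul_eval_of_dependsOn {i : ι} {f : (∀ j, X j) → ℝ≥0∞} {g : X i → ℝ≥0∞}
    (hf : Measurable f) (hg : Measurable g) (hi : DependsOn f {i}ᶜ) :
    ∫⁻ x, f x * g (x i) ∂Measure.pi μ = (∫⁻ x, f x ∂Measure.pi μ) * ∫⁻ z, g z ∂μ i := by
  classical
  rw [← lintegral_mul_const _ hf]
  refine lintegral_eq_of_lmarginal_eq {i} (by fun_prop) (by fun_prop) ?_
  ext x
  have hconst : ∀ z, f (Function.update x i z) = f x := fun z =>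
    hi fun j hj => Function.update_of_ne hj _ _
  rw [lmarginal_singleton, lmarginal_singleton]
  simp [hconst, lintegral_const_mul _ hg]

theorem pi_withDensity {d : ∀ i, X i → ℝ≥0∞} (hd : ∀ i, Measurable (d i))
    [∀ i, SigmaFinite ((μ i).withDensity (d i))] :
    Measure.pi (fun i => (μ i).withDensity (d i)) =
      (Measure.pi μ).withDensity fun x => ∏ i, d i (x i) := by
  refine Measure.pi_eq fun s hs => ?_
  have hds : ∀ i, Measurable ((s i).indicator (d i)) := fun i => (hd i).indicator (hs i)
  have hindep : iIndepFun (fun i (x : ∀ i, X i) => (s i).indicator (d i) (x i)) (Measure.pi μ) :=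
    iIndepFun_pi fun i => (hds i).aemeasurable
  have hprod : ∀ x : ∀ i, X i, (Set.univ.pi s).indicator (fun x => ∏ i, d i (x i)) x =
      ∏ i, (s i).indicator (d i) (x i) := fun x => by
    classical
    simp [Set.indicator_apply, Finset.prod_ite_zero]
  rw [withDensity_apply _ (.univ_pi hs), ← lintegral_indicator (.univ_pi hs),
    lintegral_congr hprod, lintegral_prod_eq_prod_lintegral_of_indepFun _ _ hindep
      fun i => (hds i).comp (measurable_pi_apply i)]
  refine Finset.prod_congr rfl fun i _ => ?_
  rw [withDensity_apply _ (hs i), ← lintegral_indicator (hs i),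
    ← (measurePreserving_eval μ i).lintegral_comp (hds i)]

theorem measurePreserving_curry_pi {κ : Type*} [Fintype κ] {Y : Type*} [MeasurableSpace Y]
    (ρ : ι → κ → Measure Y) [∀ i j, IsProbabilityMeasure (ρ i j)] :
    MeasurePreserving (MeasurableEquiv.curry ι κ Y) (Measure.pi fun p : ι × κ => ρ p.1 p.2)
      (Measure.pi fun i => Measure.pi (ρ i)) := by
  refine ⟨(MeasurableEquiv.curry ι κ Y).measurable, ?_⟩
  simp only [← Measure.infinitePi_eq_pi]
  exact Measure.infinitePi_map_curry ρ

end ProductMeasures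

section ChangeOfMeasure

theorem lintegral_withDensity_le_measure_add_mul {X : Type*} [MeasurableSpace X] {ν : Measure X}
    {d f : X → ℝ≥0∞} {C : ℝ≥0∞} {E : Set X} (hd : Measurable d) (hf : Measurable f)
    (hf1 : ∀ x, f x ≤ 1) (hE : MeasurableSet E) (hdE : ∀ x ∉ E, d x ≤ C) :
    ∫⁻ x, f x ∂ν.withDensity d ≤ ν.withDensity d E + C * ∫⁻ x, f x ∂ν := by
  rw [← lintegral_add_compl f hE]
  gcongr
  · exact (setLIntegral_mono measurable_one fun x _ => hf1 x).trans_eq (by simp)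
  · calc ∫⁻ x in Eᶜ, f x ∂ν.withDensity d = ∫⁻ x in Eᶜ, d x * f x ∂ν :=
          setLIntegral_withDensity_eq_setLIntegral_mul _ hd hf hE.compl
      _ ≤ ∫⁻ x in Eᶜ, C * f x ∂ν :=
          setLIntegral_mono (by fun_prop) fun x hx => mul_le_mul_left (hdE x hx) _
      _ ≤ ∫⁻ x, C * f x ∂ν := setLIntegral_le_lintegral _ _
      _ = C * ∫⁻ x, f x ∂ν := lintegral_const_mul _ hf

theorem withDensity_ofReal_toReal_rnDeriv {X : Type*} [MeasurableSpace X] {μ ν : Measure X}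
    [SigmaFinite μ] [SigmaFinite ν] (hμν : μ ≪ ν) :
    ν.withDensity (fun x => ENNReal.ofReal (μ.rnDeriv ν x).toReal) = μ := by
  refine (withDensity_congr_ae ?_).trans (Measure.withDensity_rnDeriv_eq μ ν hμν)
  filter_upwards [Measure.rnDeriv_lt_top μ ν] with x hx using ENNReal.ofReal_toReal hx.ne

variable {ι : Type*} {X : ι → Type*} [∀ i, MeasurableSpace (X i)] {μ ν : ∀ i, Measure (X i)}
  {T : Finset ι}

theorem prod_ofReal_rnDeriv_le_exp_sum_llr (x : ∀ i, X i) :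
    ∏ i ∈ T, ENNReal.ofReal ((μ i).rnDeriv (ν i) (x i)).toReal ≤
      ENNReal.ofReal (Real.exp (∑ i ∈ T, llr (μ i) (ν i) (x i))) := by
  rw [Real.exp_sum, ENNReal.ofReal_prod_of_nonneg fun i _ => (Real.exp_pos _).le]
  exact Finset.prod_le_prod' fun i _ => ENNReal.ofReal_le_ofReal (Real.le_exp_log _)

theorem measurableSet_lt_sum_llr (c : ℝ) :
    MeasurableSet {x : ∀ i, X i | c < ∑ i ∈ T, llr (μ i) (ν i) (x i)} :=
  measurableSet_lt measurable_const (by fun_prop)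

theorem dependsOn_sum_llr : DependsOn (fun x : ∀ i, X i => ∑ i ∈ T, llr (μ i) (ν i) (x i)) T :=
  fun _ _ hxy => Finset.sum_congr rfl fun i hi => by rw [hxy i hi]

variable [Fintype ι] [∀ i, IsProbabilityMeasure (μ i)] [∀ i, IsProbabilityMeasure (ν i)]

theorem pi_eq_withDensity_prod (hT : ∀ i ∉ T, μ i = ν i)
    (hac : ∀ i ∈ T, μ i ≪ ν i) :
    Measure.pi μ = (Measure.pi ν).withDensity
      fun x => ∏ i ∈ T, ENNReal.ofReal ((μ i).rnDeriv (ν i) (x i)).toReal := by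
  classical
  let d : ∀ i, X i → ℝ≥0∞ := fun i x =>
    if i ∈ T then ENNReal.ofReal ((μ i).rnDeriv (ν i) x).toReal else 1
  have hd : ∀ i, Measurable (d i) := fun i => by unfold d; split_ifs <;> fun_prop
  have hμ : ∀ i, (ν i).withDensity (d i) = μ i := fun i => by
    by_cases hi : i ∈ T
    · simpa [d, hi] using withDensity_ofReal_toReal_rnDeriv (hac i hi)
    · simp [d, hi, hT i hi]
  have : ∀ i, SigmaFinite ((ν i).withDensity (d i)) := fun i => by rw [hμ]; infer_instance
  calc Measure.pi μ = Measure.pi fun i => (ν i).withDensity (d i) := by simp_rw [hμ]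
    _ = (Measure.pi ν).withDensity fun x => ∏ i, d i (x i) := pi_withDensity hd
    _ = _ := by simp [d, Finset.prod_ite_mem]

theorem lintegral_pi_le_add_exp_mul_of_eq_off {f : (∀ i, X i) → ℝ≥0∞} (hf : Measurable f)
    (hf1 : ∀ x, f x ≤ 1) (hT : ∀ i ∉ T, μ i = ν i) (hac : ∀ i ∈ T, μ i ≪ ν i) (c : ℝ) :
    ∫⁻ x, f x ∂Measure.pi μ ≤
      Measure.pi μ {x | c < ∑ i ∈ T, llr (μ i) (ν i) (x i)} +
        ENNReal.ofReal (Real.exp c) * ∫⁻ x, f x ∂Measure.pi ν := by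
  rw [pi_eq_withDensity_prod hT hac]
  refine lintegral_withDensity_le_measure_add_mul (by fun_prop) hf hf1
    (measurableSet_lt_sum_llr c) fun x hx => (prod_ofReal_rnDeriv_le_exp_sum_llr x).trans ?_
  exact ENNReal.ofReal_le_ofReal (Real.exp_le_exp.2 (not_lt.1 hx))

theorem lintegral_pi_le_add_exp_mul_of_dependsOn {S : Finset ι} {f : (∀ i, X i) → ℝ≥0∞}
    (hf : Measurable f) (hf1 : ∀ x, f x ≤ 1) (hS : DependsOn f S)
    (hST : ∀ i ∈ S, i ∉ T → μ i = ν i) (hac : ∀ i ∈ T, μ i ≪ ν i) (c : ℝ) :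
    ∫⁻ x, f x ∂Measure.pi μ ≤
      Measure.pi μ {x | c < ∑ i ∈ T, llr (μ i) (ν i) (x i)} +
        ENNReal.ofReal (Real.exp c) * ∫⁻ x, f x ∂Measure.pi ν := by
  classical
  let ρ : ∀ i, Measure (X i) := T.piecewise μ ν
  have hρT : ∀ i ∈ T, ρ i = μ i := fun i hi => T.piecewise_eq_of_mem _ _ hi
  have hρν : ∀ i ∉ T, ρ i = ν i := fun i hi => T.piecewise_eq_of_notMem _ _ hi
  have hρS : ∀ i ∈ S, μ i = ρ i := fun i hi => by
    by_cases hiT : i ∈ T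
    · exact (hρT i hiT).symm
    · rw [hST i hi hiT, hρν i hiT]
  have : ∀ i, IsProbabilityMeasure (ρ i) := fun i => by
    by_cases hi : i ∈ T
    · rw [hρT i hi]; infer_instance
    · rw [hρν i hi]; infer_instance
  have hsum : ∀ x : ∀ i, X i,
      ∑ i ∈ T, llr (ρ i) (ν i) (x i) = ∑ i ∈ T, llr (μ i) (ν i) (x i) := fun x =>
    Finset.sum_congr rfl fun i hi => by rw [hρT i hi]
  have hevent : Measure.pi ρ {x | c < ∑ i ∈ T, llr (μ i) (ν i) (x i)} =
      Measure.pi μ {x | c < ∑ i ∈ T, llr (μ i) (ν i) (x i)} :=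
    pi_apply_congr_of_dependsOn (measurableSet_lt_sum_llr c)
      (fun _ _ hxy => congrArg (c < ·) (dependsOn_sum_llr hxy)) hρT
  rw [lintegral_pi_congr_of_dependsOn hf hS hρS, ← hevent]
  simp_rw [← hsum]
  exact lintegral_pi_le_add_exp_mul_of_eq_off hf hf1 hρν (fun i hi => hρT i hi ▸ hac i hi) c

end ChangeOfMeasure

section LimitTheorems

theorem tendsto_measure_mul_lt_sum_of_iid {Ω : Type*} [MeasurableSpace Ω] {P : Measure Ω}
    [IsProbabilityMeasure P] {Y : ℕ → Ω → ℝ} (hint : Integrable (Y 0) P)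
    (hindep : Pairwise fun i j => IndepFun (Y i) (Y j) P)
    (hident : ∀ i, IdentDistrib (Y i) (Y 0) P P) {c : ℝ} (hc : ∫ ω, Y 0 ω ∂P < c) :
    Tendsto (fun n : ℕ => P {ω | n * c < ∑ i ∈ Finset.range n, Y i ω}) atTop (𝓝 0) := by
  have hmeas : ∀ i, AEStronglyMeasurable (Y i) P := fun i =>
    (hident i).aestronglyMeasurable_iff.2 hint.aestronglyMeasurable
  have hlln : TendstoInMeasure P (fun (n : ℕ) ω => (∑ i ∈ Finset.range n, Y i ω) / n) atTop
      fun _ => ∫ ω, Y 0 ω ∂P :=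
    tendstoInMeasure_of_tendsto_ae
      (fun n => (((Finset.range n).aestronglyMeasurable_fun_sum fun i _ => hmeas i).mul_const
        (n : ℝ)⁻¹).congr (.of_forall fun ω => (div_eq_mul_inv _ _).symm))
      (strong_law_ae_real Y hint hindep hident)
  rw [tendstoInMeasure_iff_dist] at hlln
  refine tendsto_of_tendsto_of_tendsto_of_le_of_le' tendsto_const_nhds
    (hlln (c - ∫ ω, Y 0 ω ∂P) (by linarith)) (.of_forall fun _ => zero_le) ?_
  filter_upwards [eventually_gt_atTop 0] with n hn
  refine measure_mono fun ω (hω : n * c < ∑ i ∈ Finset.range n, Y i ω) => ?_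
  have hmean : c ≤ (∑ i ∈ Finset.range n, Y i ω) / n := by
    rw [le_div_iff₀ (by positivity), mul_comm]
    exact hω.le
  exact (sub_le_sub_right hmean _).trans (le_abs_self _)

theorem tendsto_infinitePi_mul_lt_sum {X : Type*} [MeasurableSpace X] {μ : Measure X}
    [IsProbabilityMeasure μ] {g : X → ℝ} (hg : Measurable g) (hint : Integrable g μ) {c : ℝ}
    (hc : ∫ x, g x ∂μ < c) :
    Tendsto (fun n : ℕ => Measure.infinitePi (fun _ : ℕ => μ)
      {x | n * c < ∑ i ∈ Finset.range n, g (x i)}) atTop (𝓝 0) := by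
  have heval : ∀ i, MeasurePreserving (fun x : ℕ → X => x i) (Measure.infinitePi fun _ => μ) μ :=
    measurePreserving_eval_infinitePi fun _ => μ
  have hident : ∀ i, IdentDistrib (fun x : ℕ → X => g (x i)) g (Measure.infinitePi fun _ => μ) μ :=
    fun i => (IdentDistrib.mk (heval i).aemeasurable aemeasurable_id
      ((heval i).map_eq.trans Measure.map_id.symm)).comp hg
  have hindep : iIndepFun (fun (i : ℕ) (x : ℕ → X) => g (x i)) (Measure.infinitePi fun _ => μ) :=
    iIndepFun_infinitePi (X := fun _ => g) fun _ => hg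
  exact tendsto_measure_mul_lt_sum_of_iid ((hident 0).integrable_iff.2 hint)
    (fun i j hij => hindep.indepFun hij) (fun i => (hident i).trans (hident 0).symm)
    ((hident 0).integral_eq.trans_lt hc)

theorem measurePreserving_restrict_fin {X : Type*} [MeasurableSpace X] (μ : Measure X)
    [IsProbabilityMeasure μ] (n : ℕ) :
    MeasurePreserving (fun (x : ℕ → X) (i : Fin n) => x i) (Measure.infinitePi fun _ => μ)
      (Measure.pi fun _ => μ) :=
  ⟨by fun_prop, (Measure.map_infinitePi_infinitePi_of_inj (P := fun _ => μ) Fin.val_injective).trans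
    (Measure.infinitePi_eq_pi _)⟩

theorem sum_fin_filter_val_lt {n m : ℕ} (hmn : m ≤ n) {M : Type*} [AddCommMonoid M] (f : ℕ → M) :
    ∑ i ∈ {i : Fin n | (i : ℕ) < m}, f i = ∑ i ∈ Finset.range m, f i := by
  rw [Finset.sum_filter, Fin.sum_univ_eq_sum_range (fun i => if i < m then f i else 0),
    ← Finset.sum_filter]
  congr 1
  ext i
  simp only [Finset.mem_filter, Finset.mem_range]
  omega

theorem tendsto_pi_mul_lt_sum {X : Type*} [MeasurableSpace X] {μ : Measure X}
    [IsProbabilityMeasure μ] {g : X → ℝ} (hg : Measurable g) (hint : Integrable g μ) {c : ℝ}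
    (hc : ∫ x, g x ∂μ < c) {F : ℕ → ℕ} (hF : Tendsto F atTop atTop)
    (hFn : ∀ᶠ n in atTop, F n ≤ n) :
    Tendsto (fun n => Measure.pi (fun _ => μ)
      {x : Fin n → X | F n * c < ∑ i ∈ {i : Fin n | (i : ℕ) < F n}, g (x i)}) atTop (𝓝 0) := by
  refine ((tendsto_infinitePi_mul_lt_sum hg hint hc).comp hF).congr' ?_
  filter_upwards [hFn] with n hn
  rw [← (measurePreserving_restrict_fin μ n).measure_preimage
    (measurableSet_lt measurable_const (by fun_prop)).nullMeasurableSet]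
  refine congrArg _ (Set.ext fun x => ?_)
  exact (congrArg (F n * c < ·) (sum_fin_filter_val_lt hn fun i => g (x i)).symm).to_iff

theorem tendsto_pi_mul_lt_sum_llr {X : Type*} [MeasurableSpace X] {μ ν : Measure X}
    [IsProbabilityMeasure μ] [IsProbabilityMeasure ν] {c : ℝ}
    (hKL : klDiv μ ν ≠ ∞) (hc : (klDiv μ ν).toReal < c) {F : ℕ → ℕ} (hF : Tendsto F atTop atTop)
    (hFn : ∀ᶠ n in atTop, F n ≤ n) :
    Tendsto (fun n => Measure.pi (fun _ => μ)
      {x : Fin n → X | F n * c < ∑ i ∈ {i : Fin n | (i : ℕ) < F n}, llr μ ν (x i)})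
      atTop (𝓝 0) := by
  obtain ⟨hac, hint⟩ := klDiv_ne_top_iff.1 hKL
  rw [toReal_klDiv_of_measure_eq hac (by simp)] at hc
  exact tendsto_pi_mul_lt_sum (measurable_llr μ ν) hint hc hF hFn

theorem coe_le_liminf_integral_div {ι : Type*} {l : Filter ι} [l.NeBot] {Ω : ι → Type*}
    [∀ i, MeasurableSpace (Ω i)] {P : ∀ i, Measure (Ω i)} {f : ∀ i, Ω i → ℝ} {L : ι → ℝ}
    {c : ℝ} (hf : ∀ i ω, 0 ≤ f i ω) (hfi : ∀ i, Integrable (f i) (P i))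
    (hL : ∀ᶠ i in l, 0 < L i) (hP : Tendsto (fun i => P i {ω | c * L i ≤ f i ω}) l (𝓝 1)) :
    (c : EReal) ≤ liminf (fun i => (((∫ ω, f i ω ∂P i) / L i : ℝ) : EReal)) l := by
  have hreal : Tendsto (fun i => c * (P i).real {ω | c * L i ≤ f i ω}) l (𝓝 c) := by
    simpa [Measure.real] using ((ENNReal.tendsto_toReal ENNReal.one_ne_top).comp hP).const_mul c
  rw [← ((continuous_coe_real_ereal.tendsto c).comp hreal).liminf_eq]
  refine liminf_le_liminf ?_
  filter_upwards [hL] with i hi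
  rw [Function.comp_apply, EReal.coe_le_coe_iff, le_div_iff₀ hi, mul_right_comm]
  exact mul_meas_ge_le_integral_of_nonneg (.of_forall (hf i)) (hfi i) _

theorem eventually_mul_log_le_half (β : ℝ) : ∀ᶠ n : ℕ in atTop, β * Real.log n ≤ n / 2 := by
  have hlog : (fun n : ℕ => β * Real.log n) =o[atTop] fun n : ℕ => (n : ℝ) :=
    (Real.isLittleO_log_id_atTop.comp_tendsto tendsto_natCast_atTop_atTop).const_mul_left β
  filter_upwards [hlog.bound (one_half_pos (α := ℝ))] with n hn
  rw [Real.norm_of_nonneg (Nat.cast_nonneg n)] at hn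
  linarith [(le_abs_self _).trans hn]

end LimitTheorems

namespace Bandit

variable {K n t : ℕ}

section Play

/-- Number of rounds at which the arm `j` is played if the arms `a` are played. -/
def playCount (a : Fin t → Fin K) (j : Fin K) : ℕ := (Finset.univ.filter fun s => a s = j).card

theorem playCount_le (a : Fin t → Fin K) (j : Fin K) : playCount a j ≤ t :=
  (Finset.card_filter_le _ _).trans_eq (by simp)

theorem sum_playCount (a : Fin t → Fin K) : ∑ j, playCount a j = t := by
  simpa [playCount] using
    (Finset.card_eq_sum_card_fiberwise (s := Finset.univ) fun s _ => Finset.mem_univ (a s)).symm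

theorem earlierPulls_lt_playCount (a : Fin t → Fin K) (s : Fin t) :
    earlierPulls a s < playCount a (a s) := by
  refine Finset.card_lt_card (Finset.ssubset_iff_of_subset ?_ |>.2 ⟨s, by simp, by simp⟩)
  exact Finset.monotone_filter_right _ fun r _ hr => hr.2

theorem playCount_take_le (a : Fin t → Fin K) {s : ℕ} (hs : s ≤ t) (j : Fin K) :
    playCount (Fin.take s hs a) j ≤ playCount a j := by
  refine Finset.card_le_card_of_injOn (Fin.castLE hs) (fun r hr => ?_)
    (Fin.castLE_injective hs).injOn
  simpa [Fin.take_apply] using Finset.mem_filter.1 hr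

theorem earlierPulls_snoc_castSucc (a : Fin t → Fin K) (j : Fin K) (s : Fin t) :
    earlierPulls (Fin.snoc a j : Fin (t + 1) → Fin K) s.castSucc = earlierPulls a s := by
  simp [earlierPulls, Finset.card_filter, -Finset.sum_boole,
    Fin.sum_univ_castSucc, (Fin.castSucc_lt_last s).not_gt]

theorem earlierPulls_snoc_last (a : Fin t → Fin K) (j : Fin K) :
    earlierPulls (Fin.snoc a j : Fin (t + 1) → Fin K) (Fin.last t) = playCount a j := by
  simp [earlierPulls, playCount, Finset.card_filter, -Finset.sum_boole,
    Fin.sum_univ_castSucc, Fin.castSucc_lt_last]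

theorem rewards_snoc_castSucc (ht : t + 1 ≤ n) (x : Table K n) (a : Fin t → Fin K) (j : Fin K)
    (s : Fin t) : rewards ht x (Fin.snoc a j : Fin (t + 1) → Fin K) s.castSucc =
      rewards (Nat.le_of_succ_le ht) x a s := by
  simp only [rewards, earlierPulls_snoc_castSucc, Fin.snoc_castSucc]

theorem rewards_snoc_last (ht : t + 1 ≤ n) (x : Table K n) (a : Fin t → Fin K) (j : Fin K) :
    rewards ht x (Fin.snoc a j : Fin (t + 1) → Fin K) (Fin.last t) =
      x j ⟨playCount a j, (playCount_le a j).trans_lt ht⟩ := by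
  simp only [rewards, earlierPulls_snoc_last, Fin.snoc_last]

theorem rewards_congr (ht : t ≤ n) {x y : Table K n} {a : Fin t → Fin K}
    (h : ∀ j (m : Fin n), (m : ℕ) < playCount a j → x j m = y j m) :
    rewards ht x a = rewards ht y a :=
  funext fun s => h _ _ (earlierPulls_lt_playCount a s)

@[fun_prop]
theorem measurable_rewards (ht : t ≤ n) (a : Fin t → Fin K) (s : Fin t) :
    Measurable fun x : Table K n => rewards ht x a s := by
  unfold rewards
  fun_prop

end Play

section PrefixProb

variable (pol : Policy K)

/-- Conditional probability, given the reward table, that the policy starts by playing the arms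
`a`. At `t = n` this is `playProb`; the prefixes `t ≤ n` are there for inductions on `t`. -/
noncomputable def prefixProb (ht : t ≤ n) (x : Table K n) (a : Fin t → Fin K) : ℝ≥0∞ :=
  ∏ s : Fin t, pol.choice s (Fin.take s s.isLt.le a,
    rewards (s.isLt.le.trans ht) x (Fin.take s s.isLt.le a)) {a s}

theorem prefixProb_snoc (ht : t + 1 ≤ n) (x : Table K n) (a : Fin t → Fin K) (j : Fin K) :
    prefixProb pol ht x (Fin.snoc a j : Fin (t + 1) → Fin K) =
      prefixProb pol (Nat.le_of_succ_le ht) x a *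
        pol.choice t (a, rewards (Nat.le_of_succ_le ht) x a) {j} := by
  have htake : ∀ (s : ℕ) (hs : s ≤ t), Fin.take s (Nat.le_succ_of_le hs)
      (Fin.snoc a j : Fin (t + 1) → Fin K) = Fin.take s hs a := fun s hs => funext fun r =>
    Fin.snoc_castSucc (α := fun _ => Fin K) j a (Fin.castLE hs r)
  rw [prefixProb, Fin.prod_univ_castSucc]
  congr 1
  · refine Finset.prod_congr rfl fun s _ => ?_
    simp only [Fin.val_castSucc, htake s s.isLt.le, Fin.snoc_castSucc]
  · simp only [Fin.val_last, htake t le_rfl, Fin.take_eq_self, Fin.snoc_last]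

theorem prefixProb_congr (ht : t ≤ n) {x y : Table K n} {a : Fin t → Fin K}
    (h : ∀ j (m : Fin n), (m : ℕ) < playCount a j → x j m = y j m) :
    prefixProb pol ht x a = prefixProb pol ht y a := by
  refine Finset.prod_congr rfl fun s _ => ?_
  rw [rewards_congr _ fun j m hm => h j m (hm.trans_le (playCount_take_le a s.isLt.le j))]

@[fun_prop]
theorem measurable_prefixProb (ht : t ≤ n) (a : Fin t → Fin K) :
    Measurable fun x : Table K n => prefixProb pol ht x a :=
  Finset.measurable_prod _ fun s _ =>
    ((pol.choice s).measurable_coe (measurableSet_singleton _)).comp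
      (measurable_const.prodMk (measurable_pi_lambda _ (measurable_rewards _ _)))

theorem sum_prefixProb_mul_succ (ht : t + 1 ≤ n) (x : Table K n)
    (f : (Fin (t + 1) → Fin K) → ℝ≥0∞) :
    ∑ a, prefixProb pol ht x a * f a = ∑ a : Fin t → Fin K, ∑ j,
      prefixProb pol ht x (Fin.snoc a j : Fin (t + 1) → Fin K) * f (Fin.snoc a j) := by
  rw [← (Fin.snocEquiv fun _ => Fin K).sum_comp, Fintype.sum_prod_type, Finset.sum_comm]
  rfl

theorem sum_prefixProb_snoc (ht : t + 1 ≤ n) (x : Table K n) (a : Fin t → Fin K) :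
    ∑ j, prefixProb pol ht x (Fin.snoc a j : Fin (t + 1) → Fin K) =
      prefixProb pol (Nat.le_of_succ_le ht) x a := by
  have := pol.isMarkov t
  simp_rw [prefixProb_snoc, ← Finset.mul_sum]
  rw [sum_measure_singleton, Finset.coe_univ, measure_univ, mul_one]

theorem sum_prefixProb (ht : t ≤ n) (x : Table K n) : ∑ a, prefixProb pol ht x a = 1 := by
  induction t with
  | zero => simp [prefixProb]
  | succ t ih => simpa [sum_prefixProb_snoc, ih] using sum_prefixProb_mul_succ pol ht x 1

end PrefixProb

section Law

variable (pol : Policy K) (θ : Env K)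

/-- Law of the reward table, the first marginal of `law`. -/
noncomputable abbrev tableLaw (θ : Env K) (n : ℕ) : Measure (Table K n) :=
  Measure.pi fun k => Measure.pi fun _ : Fin n => (θ k : Measure I)

theorem measurePreserving_curry_tableLaw :
    MeasurePreserving (MeasurableEquiv.curry (Fin K) (Fin n) I)
      (Measure.pi fun p : Fin K × Fin n => (θ p.1 : Measure I)) (tableLaw θ n) :=
  measurePreserving_curry_pi fun k (_ : Fin n) => (θ k : Measure I)

theorem lintegral_tableLaw_mul_entry {f : Table K n → ℝ≥0∞} {g : I → ℝ≥0∞} (hf : Measurable f)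
    (hg : Measurable g) (j : Fin K) (m : Fin n)
    (hfd : ∀ x y : Table K n, (∀ i s, (i, s) ≠ (j, m) → x i s = y i s) → f x = f y) :
    ∫⁻ x, f x * g (x j m) ∂tableLaw θ n =
      (∫⁻ x, f x ∂tableLaw θ n) * ∫⁻ z, g z ∂(θ j : Measure I) := by
  have hcurry := measurePreserving_curry_tableLaw θ (n := n)
  rw [← hcurry.lintegral_comp hf, ← hcurry.lintegral_comp (by fun_prop)]
  exact lintegral_pi_mul_eval_of_dependsOn (i := (j, m)) (hf.comp hcurry.measurable) hg
    fun x y hxy => hfd _ _ fun i s his => hxy (i, s) his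

@[fun_prop]
theorem measurable_playProb : Measurable (playProb (n := n) pol) :=
  measurable_from_prod_countable_left fun a => measurable_prefixProb pol le_rfl a

theorem lintegral_law {f : Outcome K n → ℝ≥0∞} (hf : Measurable f) :
    ∫⁻ ω, f ω ∂law pol θ n =
      ∫⁻ x, ∑ a, prefixProb pol le_rfl x a * f (x, a) ∂tableLaw θ n := by
  rw [law, lintegral_withDensity_eq_lintegral_mul _ (measurable_playProb pol) hf,
    lintegral_prod _ ((measurable_playProb pol).mul hf).aemeasurable]
  refine lintegral_congr fun x => ?_
  rw [lintegral_count, tsum_fintype]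
  rfl

theorem measurePreserving_fst_law : MeasurePreserving Prod.fst (law pol θ n) (tableLaw θ n) := by
  refine ⟨measurable_fst, Measure.ext fun s hs => ?_⟩
  rw [Measure.map_apply measurable_fst hs, ← lintegral_indicator_one (measurable_fst hs),
    lintegral_law pol θ (measurable_one.indicator (measurable_fst hs)),
    ← lintegral_indicator_one hs]
  refine lintegral_congr fun x => ?_
  calc ∑ a, prefixProb pol le_rfl x a * (Prod.fst ⁻¹' s).indicator 1 (x, a)
      = (∑ a, prefixProb pol le_rfl x a) * s.indicator 1 x := by rw [Finset.sum_mul]; rfl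
    _ = s.indicator 1 x := by rw [sum_prefixProb, one_mul]

instance : IsProbabilityMeasure (law pol θ n) := by
  have : IsProbabilityMeasure ((law pol θ n).map Prod.fst) := by
    rw [(measurePreserving_fst_law pol θ).map_eq]
    infer_instance
  exact Measure.isProbabilityMeasure_of_map Prod.fst

theorem law_snd_mem (A : Finset (Fin n → Fin K)) :
    law pol θ n {ω | ω.2 ∈ A} = ∫⁻ x, ∑ a ∈ A, prefixProb pol le_rfl x a ∂tableLaw θ n := by
  have hA : MeasurableSet {ω : Outcome K n | ω.2 ∈ A} := measurable_snd A.measurableSet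
  rw [← lintegral_indicator_one hA, lintegral_law pol θ (measurable_one.indicator hA)]
  simp [Set.indicator_apply]

end Law

section Regret

variable (pol : Policy K) (θ : Env K)

theorem mean_nonneg (ν : RewardDist) : 0 ≤ mean ν := integral_nonneg fun z => z.2.1

theorem mean_le_bestMean (j : Fin K) : mean (θ j) ≤ bestMean θ :=
  le_ciSup (Set.finite_range fun k => mean (θ k)).bddAbove j

theorem ofReal_mean (ν : RewardDist) :
    ENNReal.ofReal (mean ν) = ∫⁻ z, ENNReal.ofReal (z : ℝ) ∂(ν : Measure I) :=
  ofReal_integral_eq_lintegral_ofReal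
    (.of_mem_Icc 0 1 (by fun_prop) (.of_forall fun z => z.2)) (.of_forall fun z => z.2.1)

theorem lintegral_prefixProb_snoc_mul_entry (ht : t + 1 ≤ n) (a : Fin t → Fin K) (j : Fin K) :
    ∫⁻ x, prefixProb pol ht x (Fin.snoc a j : Fin (t + 1) → Fin K) *
        ENNReal.ofReal (x j ⟨playCount a j, (playCount_le a j).trans_lt ht⟩ : ℝ) ∂tableLaw θ n =
      ∫⁻ x, prefixProb pol ht x (Fin.snoc a j : Fin (t + 1) → Fin K) *
        ENNReal.ofReal (mean (θ j)) ∂tableLaw θ n := by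
  rw [lintegral_mul_const _ (by fun_prop), ofReal_mean]
  refine lintegral_tableLaw_mul_entry θ (measurable_prefixProb pol ht _)
    (g := fun z => ENNReal.ofReal (z : ℝ)) (by fun_prop) j _ fun x y hxy => ?_
  -- The past reveals the entries of row `i` below `playCount a i` only, hence not the entry
  -- `(j, playCount a j)`, which is therefore independent of the probability of the past.
  have hpast : ∀ i (m : Fin n), (m : ℕ) < playCount a i → x i m = y i m := fun i m hm =>
    hxy i m (by rintro ⟨⟩; exact hm.false)
  rw [prefixProb_snoc, prefixProb_snoc, prefixProb_congr _ _ hpast, rewards_congr _ hpast]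

theorem lintegral_sum_rewards (ht : t ≤ n) :
    ∫⁻ x, ∑ a, prefixProb pol ht x a * ∑ s, ENNReal.ofReal (rewards ht x a s : ℝ)
        ∂tableLaw θ n =
      ∫⁻ x, ∑ a, prefixProb pol ht x a * ∑ s, ENNReal.ofReal (mean (θ (a s)))
        ∂tableLaw θ n := by
  induction t with
  | zero => simp
  | succ t ih =>
    simp_rw [sum_prefixProb_mul_succ, Fin.sum_univ_castSucc, rewards_snoc_castSucc,
      rewards_snoc_last, Fin.snoc_castSucc, Fin.snoc_last, mul_add, Finset.sum_add_distrib,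
      ← Finset.sum_mul, sum_prefixProb_snoc]
    rw [lintegral_add_left (by fun_prop), lintegral_add_left (by fun_prop), ih]
    congr 1
    rw [lintegral_finsetSum _ fun a _ => by fun_prop, lintegral_finsetSum _ fun a _ => by fun_prop]
    refine Finset.sum_congr rfl fun a _ => ?_
    rw [lintegral_finsetSum _ fun j _ => by fun_prop, lintegral_finsetSum _ fun j _ => by fun_prop]
    exact Finset.sum_congr rfl fun j _ => lintegral_prefixProb_snoc_mul_entry pol θ ht a j

theorem measurable_sum_rewards :
    Measurable fun ω : Outcome K n => ∑ t, (rewards le_rfl ω.1 ω.2 t : ℝ) :=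
  measurable_from_prod_countable_left fun a => Finset.measurable_sum _ fun t _ =>
    measurable_subtype_coe.comp (measurable_rewards le_rfl a t)

theorem measurable_sum_mean :
    Measurable fun ω : Outcome K n => ∑ t, mean (θ (ω.2 t)) :=
  (measurable_of_countable fun a : Fin n → Fin K => ∑ t, mean (θ (a t))).comp measurable_snd

theorem integral_sum_rewards :
    ∫ ω, ∑ t, (rewards le_rfl ω.1 ω.2 t : ℝ) ∂law pol θ n =
      ∫ ω, ∑ t, mean (θ (ω.2 t)) ∂law pol θ n := by
  have hr : ∀ (ω : Outcome K n) t, (0 : ℝ) ≤ rewards le_rfl ω.1 ω.2 t := fun ω t =>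
    (rewards le_rfl ω.1 ω.2 t).2.1
  rw [integral_eq_lintegral_of_nonneg_ae (.of_forall fun ω => Finset.sum_nonneg fun t _ => hr ω t)
      measurable_sum_rewards.aestronglyMeasurable,
    integral_eq_lintegral_of_nonneg_ae
      (.of_forall fun ω => Finset.sum_nonneg fun t _ => mean_nonneg _)
      (measurable_sum_mean θ).aestronglyMeasurable,
    lintegral_law pol θ measurable_sum_rewards.ennreal_ofReal,
    lintegral_law pol θ (measurable_sum_mean θ).ennreal_ofReal]
  simp_rw [ENNReal.ofReal_sum_of_nonneg fun t _ => hr (_, _) t,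
    ENNReal.ofReal_sum_of_nonneg fun _ _ => mean_nonneg _, lintegral_sum_rewards]

theorem measurable_pulls (k : Fin K) : Measurable (pulls (n := n) k) :=
  (measurable_of_countable fun a : Fin n → Fin K => playCount a k).comp measurable_snd

theorem integrable_pulls (k : Fin K) :
    Integrable (fun ω : Outcome K n => (pulls k ω : ℝ)) (law pol θ n) :=
  .of_mem_Icc 0 n (measurable_from_top.comp (measurable_pulls k)).aemeasurable
    (.of_forall fun ω => ⟨Nat.cast_nonneg _, Nat.cast_le.2 (playCount_le ω.2 k)⟩)

theorem sum_integral_pulls :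
    ∑ j, ∫ ω, (pulls j ω : ℝ) ∂law pol θ n = n := by
  rw [← integral_finsetSum _ fun j _ => integrable_pulls pol θ j]
  have hsum : ∀ ω : Outcome K n, ∑ j, (pulls j ω : ℝ) = n := fun ω => by
    exact_mod_cast sum_playCount ω.2
  simp [hsum]

theorem integral_sum_mean :
    ∫ ω, ∑ t, mean (θ (ω.2 t)) ∂law pol θ n =
      ∑ j, mean (θ j) * ∫ ω, (pulls j ω : ℝ) ∂law pol θ n := by
  have hfiber : ∀ ω : Outcome K n,
      ∑ t, mean (θ (ω.2 t)) = ∑ j, mean (θ j) * (pulls j ω : ℝ) := fun ω => by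
    rw [← Finset.sum_fiberwise' Finset.univ ω.2 fun j => mean (θ j)]
    simp [pulls, mul_comm]
  simp_rw [hfiber]
  rw [integral_finsetSum _ fun j _ => (integrable_pulls pol θ j).const_mul _]
  simp_rw [integral_const_mul]

theorem integral_sum_row (k : Fin K) :
    ∫ ω, ∑ t, (ω.1 k t : ℝ) ∂law pol θ n = n * mean (θ k) := by
  have hentry : ∀ t, MeasurePreserving (fun ω : Outcome K n => ω.1 k t) (law pol θ n)
      (θ k : Measure I) := fun t =>
    ((measurePreserving_eval _ t).comp (measurePreserving_eval _ k)).comp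
      (measurePreserving_fst_law pol θ)
  have hmean : ∀ t, ∫ ω, (ω.1 k t : ℝ) ∂law pol θ n = mean (θ k) := fun t => by
    rw [mean, ← (hentry t).map_eq, integral_map (hentry t).aemeasurable (by fun_prop)]
  rw [integral_finsetSum _ fun t _ => .of_mem_Icc 0 1 (by fun_prop)
    (.of_forall fun ω => (ω.1 k t).2)]
  simp [hmean]

theorem integral_regret (k : Fin K) :
    ∫ ω, regret k ω ∂law pol θ n =
      ∑ j, (mean (θ k) - mean (θ j)) * ∫ ω, (pulls j ω : ℝ) ∂law pol θ n := by
  have hrow : Integrable (fun ω : Outcome K n => ∑ t, (ω.1 k t : ℝ)) (law pol θ n) :=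
    integrable_finsetSum _ fun t _ => .of_mem_Icc 0 1 (by fun_prop)
      (.of_forall fun ω => (ω.1 k t).2)
  have hrewards : Integrable (fun ω : Outcome K n => ∑ t, (rewards le_rfl ω.1 ω.2 t : ℝ))
      (law pol θ n) :=
    .of_mem_Icc 0 (∑ _ : Fin n, 1) measurable_sum_rewards.aemeasurable (.of_forall fun ω =>
      ⟨Finset.sum_nonneg fun t _ => (rewards le_rfl ω.1 ω.2 t).2.1,
        Finset.sum_le_sum fun t _ => (rewards le_rfl ω.1 ω.2 t).2.2⟩)
  unfold regret
  rw [integral_sub hrow hrewards, integral_sum_rewards, integral_sum_row, integral_sum_mean,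
    ← sum_integral_pulls pol θ (n := n), Finset.sum_mul, ← Finset.sum_sub_distrib]
  exact Finset.sum_congr rfl fun j _ => by ring

end Regret

section Transport

variable (pol : Policy K)

theorem dependsOn_sum_prefixProb_curry {A : Finset (Fin n → Fin K)} {k : Fin K} {F : ℕ}
    (hA : ∀ a ∈ A, playCount a k ≤ F) :
    DependsOn (fun y : Fin K × Fin n → I => ∑ a ∈ A, prefixProb pol le_rfl (Function.curry y) a)
      ({p | p.1 = k → (p.2 : ℕ) < F} : Finset (Fin K × Fin n)) := by
  refine fun y z hyz => Finset.sum_congr rfl fun a ha => prefixProb_congr pol _ fun j m hm => ?_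
  refine hyz (j, m) ?_
  simp only [Finset.coe_filter, Finset.mem_univ, true_and, Set.mem_ofPred_eq]
  rintro rfl
  exact hm.trans_le (hA a ha)

theorem law_pulls_le_le_add_exp_mul (θ : Env K) (k : Fin K) {ν : RewardDist}
    (hac : (θ k : Measure I) ≪ (ν : Measure I)) (F : ℕ) (c : ℝ) :
    law pol θ n {ω | pulls k ω ≤ F} ≤
      Measure.pi (fun _ => (θ k : Measure I)) {r : Fin n → I |
        c < ∑ i ∈ {i : Fin n | (i : ℕ) < F}, llr (θ k : Measure I) (ν : Measure I) (r i)} +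
      ENNReal.ofReal (Real.exp c) * law pol (Function.update θ k ν) n {ω | pulls k ω ≤ F} := by
  let A : Finset (Fin n → Fin K) := {a | playCount a k ≤ F}
  let T : Finset (Fin K × Fin n) := {k} ×ˢ ({i | (i : ℕ) < F} : Finset (Fin n))
  have hevent : {ω : Outcome K n | pulls k ω ≤ F} = {ω | ω.2 ∈ A} := by
    ext ω
    simp only [A, Set.mem_ofPred_eq, Finset.mem_filter, Finset.mem_univ, true_and]
    rfl
  have hT : ∀ p ∈ T, p.1 = k := fun p hp => by simpa using (Finset.mem_product.1 hp).1
  have hG : Measurable fun x : Table K n => ∑ a ∈ A, prefixProb pol le_rfl x a := by fun_prop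
  have hG1 : ∀ x : Table K n, ∑ a ∈ A, prefixProb pol le_rfl x a ≤ 1 := fun x =>
    (Finset.sum_le_univ_sum_of_nonneg fun _ => zero_le).trans_eq (sum_prefixProb pol le_rfl x)
  have hrow : MeasurePreserving (fun (y : Fin K × Fin n → I) i => y (k, i))
      (Measure.pi fun p => (θ p.1 : Measure I)) (Measure.pi fun _ : Fin n => (θ k : Measure I)) :=
    (measurePreserving_eval _ k).comp (measurePreserving_curry_tableLaw θ)
  rw [hevent, law_snd_mem, law_snd_mem,
    ← (measurePreserving_curry_tableLaw θ).lintegral_comp hG,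
    ← (measurePreserving_curry_tableLaw (Function.update θ k ν)).lintegral_comp hG,
    ← hrow.measure_preimage (measurableSet_lt measurable_const (by fun_prop)).nullMeasurableSet]
  refine (lintegral_pi_le_add_exp_mul_of_dependsOn (T := T)
    (ν := fun p => (Function.update θ k ν p.1 : Measure I)) (by fun_prop) (fun _ => hG1 _)
    (dependsOn_sum_prefixProb_curry pol (F := F) fun a ha => (Finset.mem_filter.1 ha).2)
    (fun p hpS hpT => ?_) (fun p hp => ?_) c).trans_eq ?_
  · have hp : p.1 ≠ k := fun h =>
      hpT (Finset.mem_product.2 ⟨by simp [h], by simpa [h] using hpS⟩)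
    rw [Function.update_of_ne hp]
  · rw [hT p hp, Function.update_self]
    exact hac
  · simp [T]
    rfl

end Transport

section Consistency

variable {Θ : Fin K → Set RewardDist} {α : ℝ} {pol : ℕ → Policy K} {θ : Env K}

theorem IsConsistent.isLittleO_integral_pulls (hpol : IsConsistent Θ α pol)
    (hθ : ∀ j, θ j ∈ Θ j) {j : Fin K} (hj : mean (θ j) < bestMean θ) {a : ℝ} (ha : α < a) :
    (fun n : ℕ => ∫ ω, (pulls j ω : ℝ) ∂law (pol n) θ n) =o[atTop] fun n : ℕ => (n : ℝ) ^ a := by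
  obtain ⟨kstar, hkstar, hregret⟩ := hpol θ hθ
  have hpulls : ∀ n i, 0 ≤ ∫ ω, (pulls i ω : ℝ) ∂law (pol n) θ n := fun n i =>
    integral_nonneg fun ω => Nat.cast_nonneg _
  refine IsBigO.trans_isLittleO (.of_bound (bestMean θ - mean (θ j))⁻¹ (.of_forall fun n => ?_))
    (hregret a ha)
  rw [Real.norm_of_nonneg (hpulls n j), inv_mul_eq_div, le_div_iff₀' (sub_pos.2 hj),
    integral_regret, hkstar]
  refine .trans (Finset.single_le_sum (f := fun i => (bestMean θ - mean (θ i)) *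
    ∫ ω, (pulls i ω : ℝ) ∂law (pol n) θ n) (fun i _ => ?_) (Finset.mem_univ j)) (le_abs_self _)
  exact mul_nonneg (sub_nonneg.2 (mean_le_bestMean θ i)) (hpulls n i)

theorem half_mul_law_real_pulls_le_half_le_sum (pol : Policy K) (θ : Env K) (k : Fin K) :
    n / 2 * (law pol θ n).real {ω | (pulls k ω : ℝ) ≤ n / 2} ≤
      ∑ j ∈ Finset.univ.erase k, ∫ ω, (pulls j ω : ℝ) ∂law pol θ n := by
  have hrest : ∀ ω : Outcome K n, ∑ j ∈ Finset.univ.erase k, (pulls j ω : ℝ) = n - pulls k ω :=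
    fun ω => by
      rw [eq_sub_iff_add_eq, Finset.sum_erase_add _ _ (Finset.mem_univ k)]
      exact_mod_cast sum_playCount ω.2
  have hint := integrable_finsetSum (Finset.univ.erase k) fun j _ =>
    integrable_pulls pol θ j (n := n)
  rw [← integral_finsetSum _ fun j _ => integrable_pulls pol θ j]
  convert mul_meas_ge_le_integral_of_nonneg (.of_forall fun ω =>
    Finset.sum_nonneg fun j _ => Nat.cast_nonneg (pulls j ω)) hint (n / 2) using 5 with ω
  rw [hrest]
  constructor <;> intro h <;> linarith

theorem IsConsistent.isLittleO_law_real_pulls_le_half (hpol : IsConsistent Θ α pol)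
    (hθ : ∀ j, θ j ∈ Θ j) {k : Fin K} (hk : ∀ j ≠ k, mean (θ j) < bestMean θ) {a : ℝ}
    (ha : α < a) :
    (fun n : ℕ => (law (pol n) θ n).real {ω | (pulls k ω : ℝ) ≤ n / 2}) =o[atTop]
      fun n : ℕ => (n : ℝ) ^ (a - 1) := by
  have hsum : (fun n : ℕ => ∑ j ∈ Finset.univ.erase k, ∫ ω, (pulls j ω : ℝ) ∂law (pol n) θ n)
      =o[atTop] fun n : ℕ => (n : ℝ) ^ a :=
    .fun_sum fun j hj => hpol.isLittleO_integral_pulls hθ (hk j (Finset.ne_of_mem_erase hj)) ha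
  have hmarkov : (fun n : ℕ => n / 2 * (law (pol n) θ n).real {ω | (pulls k ω : ℝ) ≤ n / 2})
      =o[atTop] fun n : ℕ => (n : ℝ) ^ a :=
    IsBigO.trans_isLittleO (.of_norm_le fun n =>
      (Real.norm_of_nonneg (by positivity)).trans_le
        (half_mul_law_real_pulls_le_half_le_sum (pol n) θ k)) hsum
  have hdiv := (isBigO_refl (fun n : ℕ => (2 / n : ℝ)) atTop).mul_isLittleO hmarkov
  refine (hdiv.congr' ?_ ?_).of_const_mul_right (c := 2)
  · filter_upwards [eventually_gt_atTop 0] with n hn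
    field_simp
  · filter_upwards [eventually_gt_atTop 0] with n hn
    rw [Real.rpow_sub_one (by positivity)]
    ring

end Consistency

section LowerBound

variable {Θ : Fin K → Set RewardDist} {α : ℝ} {pol : ℕ → Policy K} {θ : Env K} {k : Fin K}
  {ν : RewardDist} {β c : ℝ}

theorem mean_update_lt_bestMean_update (hν : bestMean θ < mean ν) {j : Fin K} (hj : j ≠ k) :
    mean (Function.update θ k ν j) < bestMean (Function.update θ k ν) := by
  calc mean (Function.update θ k ν j) = mean (θ j) := by rw [Function.update_of_ne hj]
    _ ≤ bestMean θ := mean_le_bestMean θ j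
    _ < mean (Function.update θ k ν k) := by rwa [Function.update_self]
    _ ≤ bestMean (Function.update θ k ν) := mean_le_bestMean _ k

theorem IsConsistent.tendsto_exp_mul_law_pulls_le (hpol : IsConsistent Θ α pol)
    (hθ : ∀ j, θ j ∈ Θ j) (hk : ∀ j ≠ k, mean (θ j) < bestMean θ) (hβ : 0 ≤ β) (hc : 0 ≤ c)
    (hcβ : c * β < 1 - α) :
    Tendsto (fun n : ℕ => ENNReal.ofReal (Real.exp (⌊β * Real.log n⌋₊ * c)) *
      law (pol n) θ n {ω | pulls k ω ≤ ⌊β * Real.log n⌋₊}) atTop (𝓝 0) := by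
  have hrare := hpol.isLittleO_law_real_pulls_le_half hθ hk (a := 1 - c * β) (by linarith)
  have hpow := ((isBigO_refl (fun n : ℕ => (n : ℝ) ^ (c * β)) atTop).mul_isLittleO hrare).congr'
    .rfl (g₂ := fun _ => 1) <| by
      filter_upwards [eventually_gt_atTop 0] with n hn
      rw [← Real.rpow_add (by positivity)]
      simp
  refine tendsto_of_tendsto_of_tendsto_of_le_of_le' tendsto_const_nhds
    (by simpa using ENNReal.tendsto_ofReal ((isLittleO_one_iff ℝ).1 hpow))
    (.of_forall fun _ => zero_le) ?_
  filter_upwards [eventually_gt_atTop 0, eventually_mul_log_le_half β] with n hn hhalf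
  have hfloor : (⌊β * Real.log n⌋₊ : ℝ) ≤ β * Real.log n :=
    Nat.floor_le (mul_nonneg hβ (Real.log_natCast_nonneg n))
  rw [ENNReal.ofReal_mul (by positivity), ofReal_measureReal]
  refine mul_le_mul' (ENNReal.ofReal_le_ofReal ?_) (measure_mono fun ω hω => ?_)
  · rw [Real.rpow_def_of_pos (by positivity)]
    exact Real.exp_le_exp.2 ((mul_le_mul_of_nonneg_right hfloor hc).trans_eq (by ring))
  · exact (Nat.cast_le.2 hω).trans (hfloor.trans hhalf)

theorem IsConsistent.tendsto_law_pulls_le_of_klDiv_lt (hpol : IsConsistent Θ α pol)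
    (hθ : ∀ j, θ j ∈ Θ j) (hνΘ : ν ∈ Θ k) (hν : bestMean θ < mean ν) (hβ : 0 < β)
    (hKL : klDiv (θ k : Measure I) (ν : Measure I) < ENNReal.ofReal ((1 - α) / β)) :
    Tendsto (fun n : ℕ => law (pol n) θ n {ω | pulls k ω ≤ ⌊β * Real.log n⌋₊}) atTop (𝓝 0) := by
  obtain ⟨c, hKLc, hcβ⟩ := exists_between ((ENNReal.lt_ofReal_iff_toReal_lt hKL.ne_top).1 hKL)
  rw [lt_div_iff₀ hβ] at hcβ
  have hF : Tendsto (fun n : ℕ => ⌊β * Real.log n⌋₊) atTop atTop :=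
    tendsto_nat_floor_atTop.comp
      ((Real.tendsto_log_atTop.comp tendsto_natCast_atTop_atTop).const_mul_atTop hβ)
  have hFn : ∀ᶠ n : ℕ in atTop, ⌊β * Real.log n⌋₊ ≤ n := by
    filter_upwards [eventually_mul_log_le_half β] with n hn
    exact Nat.floor_le_of_le (hn.trans (half_le_self (Nat.cast_nonneg n)))
  have hθν : ∀ j, Function.update θ k ν j ∈ Θ j :=
    (Function.forall_update_iff θ fun j μ => μ ∈ Θ j).2 ⟨hνΘ, fun j _ => hθ j⟩
  have hunlikely := tendsto_pi_mul_lt_sum_llr hKL.ne_top hKLc hF hFn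
  have hrare := hpol.tendsto_exp_mul_law_pulls_le hθν
    (fun j hj => mean_update_lt_bestMean_update hν hj) hβ.le
    (ENNReal.toReal_nonneg.trans hKLc.le) hcβ
  refine tendsto_of_tendsto_of_tendsto_of_le_of_le tendsto_const_nhds
    (by simpa using hunlikely.add hrare) (fun _ => zero_le) fun n => ?_
  exact law_pulls_le_le_add_exp_mul (pol n) θ k (klDiv_ne_top_iff.1 hKL.ne_top).1 _ _

theorem IsConsistent.tendsto_law_mul_log_le_pulls (hpol : IsConsistent Θ α pol)
    (hθ : ∀ j, θ j ∈ Θ j) (hβ : 0 < β) (hD : infKL Θ θ k < ENNReal.ofReal ((1 - α) / β)) :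
    Tendsto (fun n : ℕ => law (pol n) θ n {ω | β * Real.log n ≤ pulls k ω}) atTop (𝓝 1) := by
  simp only [infKL, iInf_lt_iff] at hD
  obtain ⟨ν, ⟨hνΘ, hν⟩, hKL⟩ := hD
  have hfew := hpol.tendsto_law_pulls_le_of_klDiv_lt hθ hνΘ hν hβ hKL
  refine tendsto_of_tendsto_of_tendsto_of_le_of_le
    (by simpa using ENNReal.Tendsto.sub tendsto_const_nhds hfew (.inl ENNReal.one_ne_top))
    tendsto_const_nhds (fun n => ?_) fun n => prob_le_one
  exact (prob_compl_eq_one_sub (measurable_pulls k measurableSet_Iic)).symm.trans_le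
    (measure_mono fun ω hω => (Nat.lt_of_floor_lt (not_le.1 hω)).le)

theorem IsConsistent.tendsto_law_one_sub_mul_le_pulls (hpol : IsConsistent Θ α pol)
    (hα1 : α ≤ 1) (hθ : ∀ j, θ j ∈ Θ j) (hD0 : 0 < infKL Θ θ k) (hD : infKL Θ θ k < ∞) {ε : ℝ}
    (hε : 0 < ε) :
    Tendsto (fun n : ℕ => law (pol n) θ n
      {ω | (1 - ε) * ((1 - α) * Real.log n / (infKL Θ θ k).toReal) ≤ pulls k ω}) atTop (𝓝 1) := by
  have hDpos : 0 < (infKL Θ θ k).toReal := ENNReal.toReal_pos hD0.ne' hD.ne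
  have hthreshold : ∀ n : ℕ, (1 - ε) * ((1 - α) * Real.log n / (infKL Θ θ k).toReal) =
      (1 - ε) * (1 - α) / (infKL Θ θ k).toReal * Real.log n := fun n => by ring
  simp_rw [hthreshold]
  rcases le_or_gt ((1 - ε) * (1 - α)) 0 with hle | hpos
  · have huniv : ∀ n : ℕ, {ω : Outcome K n |
        (1 - ε) * (1 - α) / (infKL Θ θ k).toReal * Real.log n ≤ pulls k ω} = Set.univ := fun n =>
      Set.eq_univ_of_forall fun ω => (mul_nonpos_of_nonpos_of_nonneg
        (div_nonpos_of_nonpos_of_nonneg hle hDpos.le) (Real.log_natCast_nonneg n)).trans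
          (Nat.cast_nonneg _)
    simp [huniv]
  · have hα : α < 1 := hα1.lt_of_ne (by rintro rfl; simp at hpos)
    refine hpol.tendsto_law_mul_log_le_pulls hθ (div_pos hpos hDpos) ?_
    rw [ENNReal.lt_ofReal_iff_toReal_lt hD.ne, div_div_eq_mul_div, lt_div_iff₀ hpos]
    nlinarith [mul_pos (mul_pos hε (sub_pos.2 hα)) hDpos]

theorem IsConsistent.div_infKL_le_liminf (hpol : IsConsistent Θ α pol)
    (hα1 : α ≤ 1) (hθ : ∀ j, θ j ∈ Θ j) (hD0 : 0 < infKL Θ θ k) (hD : infKL Θ θ k < ∞) :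
    (((1 - α) / (infKL Θ θ k).toReal : ℝ) : EReal) ≤ liminf (fun n : ℕ =>
      (((∫ ω, (pulls k ω : ℝ) ∂law (pol n) θ n) / Real.log n : ℝ) : EReal)) atTop := by
  have hslack : Tendsto (fun ε : ℝ => ((1 - ε) * ((1 - α) / (infKL Θ θ k).toReal) : ℝ)) (𝓝[>] 0)
      (𝓝 ((1 - α) / (infKL Θ θ k).toReal)) :=
    (Continuous.tendsto' (by fun_prop) _ _ (by simp)).mono_left nhdsWithin_le_nhds
  refine le_of_tendsto ((continuous_coe_real_ereal.tendsto _).comp hslack) ?_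
  filter_upwards [self_mem_nhdsWithin] with ε hε
  refine coe_le_liminf_integral_div (fun n ω => Nat.cast_nonneg _)
    (fun n => integrable_pulls _ θ k) ?_ ?_
  · filter_upwards [eventually_gt_atTop 1] with n hn using Real.log_pos (Nat.one_lt_cast.2 hn)
  · simpa only [mul_assoc, div_mul_eq_mul_div] using
      hpol.tendsto_law_one_sub_mul_le_pulls hα1 hθ hD0 hD hε

end LowerBound

end Bandit

theorem mainTheorem1_general {K : ℕ} (Θ : Fin K → Set Bandit.RewardDist)
    (α : ℝ) (hα1 : α ≤ 1)
    (pol : ℕ → Bandit.Policy K) (hpol : Bandit.IsConsistent Θ α pol)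
    (θ : Bandit.Env K) (hθ : ∀ k, θ k ∈ Θ k)
    (k : Fin K)
    (hD0 : 0 < Bandit.infKL Θ θ k) (hD : Bandit.infKL Θ θ k < ∞) :
    (∀ ε : ℝ, 0 < ε →
      Tendsto
        (fun n : ℕ => Bandit.law (pol n) θ n
          {ω | (1 - ε) * ((1 - α) * Real.log n / (Bandit.infKL Θ θ k).toReal)
            ≤ (Bandit.pulls k ω : ℝ)})
        atTop (𝓝 1)) ∧
    (((1 - α) / (Bandit.infKL Θ θ k).toReal : ℝ) : EReal) ≤
      liminf
        (fun n : ℕ =>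
          (((∫ ω, (Bandit.pulls k ω : ℝ) ∂(Bandit.law (pol n) θ n)) / Real.log n : ℝ) : EReal))
        atTop :=
  ⟨fun _ hε => hpol.tendsto_law_one_sub_mul_le_pulls hα1 hθ hD0 hD hε,
    hpol.div_infKL_le_liminf hα1 hθ hD0 hD⟩

theorem mainTheorem1 {K : ℕ} (Θ : Fin K → Set Bandit.RewardDist)
    (α : ℝ) (hα0 : 0 ≤ α) (hα1 : α ≤ 1)
    (pol : ℕ → Bandit.Policy K) (hpol : Bandit.IsConsistent Θ α pol)
    (θ : Bandit.Env K) (hθ : ∀ k, θ k ∈ Θ k)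
    (k : Fin K) (hk : Bandit.mean (θ k) < Bandit.bestMean θ)
    (hD0 : 0 < Bandit.infKL Θ θ k) (hD : Bandit.infKL Θ θ k < ∞) :
    (∀ ε : ℝ, 0 < ε →
      Tendsto
        (fun n : ℕ => Bandit.law (pol n) θ n
          {ω | (1 - ε) * ((1 - α) * Real.log n / (Bandit.infKL Θ θ k).toReal)
            ≤ (Bandit.pulls k ω : ℝ)})
        atTop (𝓝 1)) ∧
    (((1 - α) / (Bandit.infKL Θ θ k).toReal : ℝ) : EReal) ≤
      liminf
        (fun n : ℕ =>
          (((∫ ω, (Bandit.pulls k ω : ℝ) ∂(Bandit.law (pol n) θ n)) / Real.log n : ℝ) : EReal))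
        atTop :=
  mainTheorem1_general Θ α hα1 pol hpol θ hθ k hD0 hD
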